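/- Let $k$ be a field, let $e(k)=1$ if $\operatorname{char}k=0$ and $e(k)=\operatorname{char}k$ otherwise. Let $n_1,\dots,n_m$ be positive integers with $\gcd(\operatorname{lcm}(n_1,\dots,n_m),e(k))=1$, and let $x_1,\dots,x_m$ be algebraically independent variables over $k$. For a positive integer $d$ and an element $a$ of a commutative ring, let $F_d(a)$ be the $d\times d$ Frobenius companion matrix of $t^d-a$ (ones on the subdiagonal, last column $(a,0,\dots,0)^T$, zeros elsewhere), and let $A\boxplus B=A\otimes I+I\otimes B$ denote the Kronecker sum of square matrices. Put $$q(z)=q(\{n_i\},\{x_j\};z)=\det\bigl(z\cdot I-F_{n_1}(x_1)\boxplus\dots\boxplus F_{n_m}(x_m)\bigr)\in k[x_1,\dots,x_m][z].$$ Then: 1. $q$ is irreducible as a polynomial in the variables $z,x_1,\dots,x_m$ over $k$, that is, in $k[x_1,\dots,x_m][z]$. 2. $q$ is irreducible as a polynomial in $z$ over the field $k(x_1,\dots,x_m)$. 3. $q$ is the minimal polynomial of $\theta=x_1^{1/n_1}+\dots+x_m^{1/n_m}$ over $k(x_1,\dots,x_m)$. More precisely, if $K$ is an extension field of $k$, the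 elements $x_1,\dots,x_m\in K$ are algebraically independent over $k$, and $r_1,\dots,r_m\in K$ satisfy $r_j^{n_j}=x_j$ for all $j$, then the minimal polynomial of $r_1+\dots+r_m$ over the subfield $k(x_1,\dots,x_m)\subseteq K$ is $q(\{n_i\},\{x_j\};z)$. -/

import Mathlib

open scoped Kronecker

/-- The Kronecker sum `A ⊞ B = A ⊗ I + I ⊗ B` of two square matrices. -/
def kroneckerSum {R ι κ : Type*} [CommRing R] [DecidableEq ι] [DecidableEq κ]
    (A : Matrix ι ι R) (B : Matrix κ κ R) : Matrix (ι × κ) (ι × κ) R :=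
  A ⊗ₖ (1 : Matrix κ κ R) + (1 : Matrix ι ι R) ⊗ₖ B

/-- The iterated Kronecker sum `A 0 ⊞ (A 1 ⊞ (⋯ ⊞ A (m - 1)))`, with rows and columns labelled by
multi-indices `(i_0, …, i_{m-1})`. The empty Kronecker sum is the `1 × 1` zero matrix, which is
neutral for `⊞`. -/
def iteratedKroneckerSum {R : Type*} [CommRing R] :
    {m : ℕ} → {n : Fin m → ℕ} → ((j : Fin m) → Matrix (Fin (n j)) (Fin (n j)) R) →
      Matrix ((j : Fin m) → Fin (n j)) ((j : Fin m) → Fin (n j)) R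
  | 0, _, _ => 0
  | _ + 1, n, A =>
      Matrix.reindex (Fin.consEquiv fun j => Fin (n j)) (Fin.consEquiv fun j => Fin (n j))
        (kroneckerSum (A 0) (iteratedKroneckerSum fun j => A j.succ))

/-- The `d × d` Frobenius companion matrix of a monic polynomial
`f = t ^ d + a_{d-1} t ^ (d-1) + ⋯ + a_0`: ones on the subdiagonal, last column
`(-a_0, …, -a_{d-1})`, zeros elsewhere. -/
def frobeniusCompanion {R : Type*} [CommRing R] (d : ℕ) (f : Polynomial R) :
    Matrix (Fin d) (Fin d) R :=
  Matrix.of fun i j =>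
    if (j : ℕ) + 1 = d then -f.coeff i else if (i : ℕ) = (j : ℕ) + 1 then 1 else 0

/-- The polynomial `q({n_i}, {x_j}; z)`: the characteristic polynomial, in the variable `z`, of the
Kronecker sum of the companion matrices of the polynomials `t ^ (n j) - x j`. -/
noncomputable def rootSumPoly {R : Type*} [CommRing R] {m : ℕ} (n : Fin m → ℕ) (x : Fin m → R) :
    Polynomial R :=
  (iteratedKroneckerSum fun j =>
    frobeniusCompanion (n j) (Polynomial.X ^ n j - Polynomial.C (x j))).charpoly

/-! Powers of `r j` with `r j ^ n j = x j` form a left eigenvector of each companion matrix, and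
their products one of the Kronecker sum, so `∑ r j` is a root of `q`. Substitute `X j ^ n j` for
`x_j` over the algebraic closure: `∑ X j` becomes a root of `q`, hence of one factor in any monic
factorization. That factor's coefficients are invariant under `X j ↦ ζ_j ^ a_j * X j` with `ζ_j` a
primitive `n j`-th root of unity, so it vanishes at all `∏ n j` linear forms `∑ ζ_j ^ a_j * X j`.
These are distinct and `q` has degree `∏ n j`, so the other factor is constant. Gauss's lemma then
gives irreducibility over the fraction field, and the isomorphism with `k(x_1, …, x_m)` in `K` gives
the minimal polynomial. -/

/-- The vector of powers of a `d`-th root of `a` is a left eigenvector of the companion matrix of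
`t ^ d - a`. -/
lemma vecMul_frobeniusCompanion {R : Type*} [CommRing R] {d : ℕ} (a r : R) (hr : r ^ d = a) :
    Matrix.vecMul (fun i : Fin d => r ^ (i : ℕ))
      (frobeniusCompanion d (Polynomial.X ^ d - Polynomial.C a)) =
      r • fun i : Fin d => r ^ (i : ℕ) := by
  ext j
  have hd : 0 < d := j.pos
  simp only [Matrix.vecMul, dotProduct, frobeniusCompanion, Matrix.of_apply, Pi.smul_apply,
    smul_eq_mul]
  by_cases hj : (j : ℕ) + 1 = d
  -- The last column has its only nonzero entry `a` in row `0`, and `a = r ^ d = r * r ^ j`.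
  · rw [Finset.sum_eq_single (⟨0, hd⟩ : Fin d)]
    · simp only [hj, if_true, ← pow_succ', hr]
      simp [Polynomial.coeff_X_pow, hd.ne]
    · intro i _ hi
      have hi0 : (i : ℕ) ≠ 0 := fun h => hi (Fin.ext h)
      simp [hj, Polynomial.coeff_X_pow, Polynomial.coeff_C, i.isLt.ne, hi0]
    · simp
  · have hj' : (j : ℕ) + 1 < d := by omega
    rw [Finset.sum_eq_single (⟨j + 1, hj'⟩ : Fin d)]
    · simp [hj, pow_succ']
    · intro i _ hi
      have hi0 : (i : ℕ) ≠ j + 1 := fun h => hi (Fin.ext h)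
      simp [hj, hi0]
    · simp

/-- Left eigenvectors of the summands multiply to a left eigenvector of the Kronecker sum, and
their eigenvalues add. -/
lemma vecMul_iteratedKroneckerSum {R : Type*} [CommRing R] {m : ℕ} {n : Fin m → ℕ}
    (A : (j : Fin m) → Matrix (Fin (n j)) (Fin (n j)) R) (v : (j : Fin m) → Fin (n j) → R)
    (c : Fin m → R) (h : ∀ j, Matrix.vecMul (v j) (A j) = c j • v j) :
    Matrix.vecMul (fun i => ∏ j, v j (i j)) (iteratedKroneckerSum A) =
      (∑ j, c j) • fun i : (j : Fin m) → Fin (n j) => ∏ j, v j (i j) := by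
  induction m with
  | zero => simp [iteratedKroneckerSum]
  | succ m ih =>
    ext i
    have h0 := congrFun (h 0) (i 0)
    have h1 := congrFun (ih (fun j => A j.succ) (fun j => v j.succ) (fun j => c j.succ)
      fun j => h j.succ) (fun j => i j.succ)
    simp only [Matrix.vecMul, dotProduct, Pi.smul_apply, smul_eq_mul] at h0 h1 ⊢
    rw [← (Fin.consEquiv fun j => Fin (n j)).sum_comp, Fintype.sum_prod_type]
    have hi : (Fin.consEquiv fun j => Fin (n j)).symm i = (i 0, fun j : Fin m => i j.succ) := rfl
    simp only [iteratedKroneckerSum, Matrix.reindex_apply, Matrix.submatrix_apply,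
      Equiv.symm_apply_apply, hi, kroneckerSum, Matrix.add_apply, Matrix.kroneckerMap_apply,
      Fin.consEquiv_apply, Fin.prod_univ_succ, Fin.sum_univ_succ, Fin.cons_zero, Fin.cons_succ,
      Matrix.one_apply, mul_add, Finset.sum_add_distrib, mul_ite, mul_one, mul_zero, ite_mul,
      one_mul, zero_mul, Finset.sum_ite_eq', Finset.mem_univ, if_true]
    -- In the `1 ⊗ B` part the Kronecker delta is on the outer index; exchanging the sums lets it
    -- collapse.
    rw [Finset.sum_comm (f := fun a b => if a = i 0 then _ else _)]
    simp only [Finset.sum_ite_eq', Finset.mem_univ, if_true, mul_assoc]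
    rw [← Finset.mul_sum, h1]
    simp only [mul_right_comm _ _ (A 0 _ _), ← mul_assoc]
    rw [← Finset.sum_mul, h0]
    ring

lemma iteratedKroneckerSum_map {R S : Type*} [CommRing R] [CommRing S] (f : R →+* S) {m : ℕ}
    {n : Fin m → ℕ} (A : (j : Fin m) → Matrix (Fin (n j)) (Fin (n j)) R) :
    (iteratedKroneckerSum A).map f = iteratedKroneckerSum fun j => (A j).map f := by
  induction m with
  | zero => ext; simp [iteratedKroneckerSum]
  | succ m ih =>
    ext i i'
    have h1 := congrFun (congrFun (ih fun j => A j.succ)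
      (Fin.tail i)) (Fin.tail i')
    simp only [Matrix.map_apply] at h1
    simp [iteratedKroneckerSum, kroneckerSum, Matrix.one_apply, apply_ite f, h1]

/-- Base change serves three purposes: the substitution of powers, passage to fractions, and
evaluation in `K`. -/
lemma rootSumPoly_map {R S : Type*} [CommRing R] [CommRing S] (f : R →+* S) {m : ℕ}
    (n : Fin m → ℕ) (x : Fin m → R) :
    (rootSumPoly n x).map f = rootSumPoly n fun j => f (x j) := by
  rw [rootSumPoly, ← Matrix.charpoly_map, iteratedKroneckerSum_map, rootSumPoly]
  congr 2
  ext j a b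
  simp [frobeniusCompanion, apply_ite f, Polynomial.coeff_X_pow, Polynomial.coeff_C]

lemma monic_rootSumPoly {R : Type*} [CommRing R] {m : ℕ} (n : Fin m → ℕ) (x : Fin m → R) :
    (rootSumPoly n x).Monic :=
  Matrix.charpoly_monic _

lemma natDegree_rootSumPoly {R : Type*} [CommRing R] [Nontrivial R] {m : ℕ} (n : Fin m → ℕ)
    (x : Fin m → R) : (rootSumPoly n x).natDegree = ∏ j, n j := by
  rw [rootSumPoly, Matrix.charpoly_natDegree_eq_dim]
  simp

lemma eval_rootSumPoly_sum {R : Type*} [CommRing R] [IsDomain R] {m : ℕ} {n : Fin m → ℕ}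
    (hn : ∀ j, 0 < n j) {x r : Fin m → R} (hr : ∀ j, r j ^ n j = x j) :
    (rootSumPoly n x).eval (∑ j, r j) = 0 := by
  rw [rootSumPoly, Matrix.eval_charpoly, ← Matrix.exists_vecMul_eq_zero_iff]
  refine ⟨fun i => ∏ j, r j ^ (i j : ℕ), fun h => ?_, ?_⟩
  -- The eigenvector is nonzero: its entry at the zero multi-index is an empty power, `1`.
  · simpa using congrFun h fun j => ⟨0, hn j⟩
  · rw [Matrix.vecMul_sub, vecMul_iteratedKroneckerSum _ (fun j i => r j ^ (i : ℕ)) r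
      fun j => vecMul_frobeniusCompanion _ _ (hr j)]
    ext i
    rw [Matrix.scalar_apply, Pi.sub_apply, Matrix.vecMul_diagonal]
    simp [mul_comm]

/-- A nonzero polynomial over `l[x_1, …, x_m]` whose coefficients are fixed by the substitutions
`x_j ↦ ζ_j ^ a x_j` and which vanishes at `x_1 + ⋯ + x_m` has at least `n_1 ⋯ n_m` roots. -/
lemma prod_le_natDegree_of_eval_sum_X {k l : Type*} [Field k] [Field l] [Algebra k l] {m : ℕ}
    {n : Fin m → ℕ} {ζ : Fin m → l} (hζ : ∀ j, IsPrimitiveRoot (ζ j) (n j))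
    (f : Polynomial (MvPolynomial (Fin m) k)) (hf : f.Monic)
    (h : (f.map (MvPolynomial.aeval fun j => (MvPolynomial.X j : MvPolynomial (Fin m) l) ^ n j :
      MvPolynomial (Fin m) k →ₐ[k] MvPolynomial (Fin m) l).toRingHom).eval
      (∑ j, MvPolynomial.X j) = 0) :
    ∏ j, n j ≤ f.natDegree := by
  classical
  set φ : MvPolynomial (Fin m) k →ₐ[k] MvPolynomial (Fin m) l :=
    MvPolynomial.aeval fun j => (MvPolynomial.X j : MvPolynomial (Fin m) l) ^ n j
  let root : ((j : Fin m) → Fin (n j)) → MvPolynomial (Fin m) l := fun a =>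
    ∑ j, MvPolynomial.C (ζ j ^ (a j : ℕ)) * MvPolynomial.X j
  -- The coefficient of `X j` recovers `ζ j ^ a j`, and the exponents are below the order `n j`.
  have hroot : Function.Injective root := by
    intro a b hab
    ext j
    have hc := congrArg (MvPolynomial.coeff (Finsupp.single j 1)) hab
    simp only [root, MvPolynomial.coeff_sum, MvPolynomial.coeff_C_mul, MvPolynomial.coeff_X,
      Finsupp.single_left_inj one_ne_zero, mul_ite, mul_one, mul_zero, Finset.sum_ite_eq',
      Finset.mem_univ, if_true] at hc
    exact (hζ j).pow_inj (a j).isLt (b j).isLt hc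
  have hmem : ∀ a, root a ∈ (f.map φ.toRingHom).roots := by
    intro a
    rw [Polynomial.mem_roots (hf.map _).ne_zero, Polynomial.IsRoot]
    let σ : MvPolynomial (Fin m) l →ₐ[l] MvPolynomial (Fin m) l :=
      MvPolynomial.aeval fun j => MvPolynomial.C (ζ j ^ (a j : ℕ)) * MvPolynomial.X j
    -- `σ` fixes each `X j ^ n j`, hence the coefficients of the mapped polynomial, so it carries
    -- roots to roots.
    have hσ : σ.toRingHom.comp φ.toRingHom = φ.toRingHom := by
      have : (σ.restrictScalars k).comp φ = φ := by
        apply MvPolynomial.algHom_ext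
        intro j
        have hone : (ζ j ^ (a j : ℕ)) ^ n j = 1 := by
          rw [pow_right_comm, (hζ j).pow_eq_one, one_pow]
        simp only [φ, σ, AlgHom.comp_apply, AlgHom.restrictScalars_apply, MvPolynomial.aeval_X,
          map_pow, mul_pow]
        rw [← map_pow, ← map_pow, hone, map_one, one_mul]
      exact congrArg AlgHom.toRingHom this
    have := congrArg σ.toRingHom h
    rw [map_zero, ← Polynomial.eval_map_apply, Polynomial.map_map, hσ] at this
    simpa [σ, root] using this
  calc ∏ j, n j = (Finset.univ.image root).card := by
        rw [Finset.card_image_of_injective _ hroot]; simp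
    _ ≤ (f.map φ.toRingHom).natDegree := by
        apply Polynomial.card_le_degree_of_subset_roots
        intro y hy
        obtain ⟨a, -, rfl⟩ := Finset.mem_image.1 hy
        exact hmem a
    _ = f.natDegree := hf.natDegree_map _

lemma natCast_ne_zero_of_gcd_lcm_ringExpChar {k ι : Type*} [Field k] [Fintype ι] {n : ι → ℕ}
    (hn : ∀ j, 0 < n j) (hgcd : Nat.gcd (Finset.univ.lcm n) (ringExpChar k) = 1) (j : ι) :
    (n j : k) ≠ 0 := by
  intro h0
  have hdvd : ringChar k ∣ n j := (ringChar.spec k _).1 h0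
  have hc : ringChar k ≠ 0 := fun h => (hn j).ne' (by simpa [h] using hdvd)
  -- `ringExpChar` is the maximum of `ringChar` and `1`.
  have he : ringExpChar k = ringChar k := by
    have := Nat.pos_of_ne_zero hc
    simp [ringExpChar]; omega
  rw [he] at hgcd
  have h1 : ringChar k ∣ 1 :=
    hgcd ▸ Nat.dvd_gcd (hdvd.trans (Finset.dvd_lcm (Finset.mem_univ j))) dvd_rfl
  exact CharP.ringChar_ne_one (Nat.dvd_one.1 h1)

lemma irreducible_rootSumPoly_X {k : Type*} [Field k] {m : ℕ} {n : Fin m → ℕ}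
    (hn : ∀ j, 0 < n j) (hk : ∀ j, (n j : k) ≠ 0) :
    Irreducible (rootSumPoly n (MvPolynomial.X : Fin m → MvPolynomial (Fin m) k)) := by
  have hζ : ∀ j, ∃ ζ : AlgebraicClosure k, IsPrimitiveRoot ζ (n j) := fun j => by
    -- Invertibility of `n j` makes `t ^ n j - 1` separable, which yields a primitive root.
    have : NeZero (n j : AlgebraicClosure k) :=
      ⟨by simpa using (map_ne_zero (algebraMap k (AlgebraicClosure k))).2 (hk j)⟩
    exact HasEnoughRootsOfUnity.exists_primitiveRoot _ _
  choose ζ hζ using hζ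
  have hN : 0 < ∏ j, n j := Finset.prod_pos fun j _ => hn j
  set q := rootSumPoly n (MvPolynomial.X : Fin m → MvPolynomial (Fin m) k) with hq
  have hqm : q.Monic := monic_rootSumPoly _ _
  have hdeg : q.natDegree = ∏ j, n j := natDegree_rootSumPoly _ _
  rw [hqm.irreducible_iff_natDegree]
  refine ⟨fun h => by simp [h] at hdeg; omega, fun f g hf hg hfg => ?_⟩
  let φ : MvPolynomial (Fin m) k →ₐ[k] MvPolynomial (Fin m) (AlgebraicClosure k) :=
    MvPolynomial.aeval fun j => MvPolynomial.X j ^ n j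
  have hroot : (q.map φ.toRingHom).eval (∑ j, MvPolynomial.X j) = 0 := by
    rw [hq, rootSumPoly_map]
    exact eval_rootSumPoly_sum hn fun j => by simp [φ]
  have hsum : f.natDegree + g.natDegree = ∏ j, n j := by
    rw [← hf.natDegree_mul hg, hfg, hdeg]
  rw [← hfg, Polynomial.map_mul, Polynomial.eval_mul, mul_eq_zero] at hroot
  rcases hroot with h | h
  · have := prod_le_natDegree_of_eval_sum_X hζ f hf h
    omega
  · have := prod_le_natDegree_of_eval_sum_X hζ g hg h
    omega

theorem mainTheorem3 {k : Type*} [Field k] {m : ℕ} (n : Fin m → ℕ) (hn : ∀ j, 0 < n j)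
    (hgcd : Nat.gcd (Finset.univ.lcm n) (ringExpChar k) = 1) :
    -- irreducibility in `k[x_1, …, x_m][z]`
    Irreducible (rootSumPoly n (MvPolynomial.X : Fin m → MvPolynomial (Fin m) k)) ∧
    -- irreducibility in `k(x_1, …, x_m)[z]`
    Irreducible (rootSumPoly n fun j =>
      algebraMap (MvPolynomial (Fin m) k) (FractionRing (MvPolynomial (Fin m) k))
        (MvPolynomial.X j)) ∧
    -- minimal polynomial of `θ = ∑ x_j ^ (1 / n_j)` over `k(x_1, …, x_m)`, for algebraically
    -- independent elements `x_j` of a field `K` and any choice `r_j` of the roots in `K`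
    ∀ {K : Type*} [Field K] [Algebra k K] (x : Fin m → K), AlgebraicIndependent k x →
      ∀ r : Fin m → K, (∀ j, r j ^ n j = x j) →
        minpoly (IntermediateField.adjoin k (Set.range x)) (∑ j, r j) =
          rootSumPoly n fun j =>
            (⟨x j, IntermediateField.subset_adjoin k (Set.range x) (Set.mem_range_self j)⟩ :
              IntermediateField.adjoin k (Set.range x)) := by
  have hirr := irreducible_rootSumPoly_X hn (natCast_ne_zero_of_gcd_lcm_ringExpChar hn hgcd)
  have hirr' := hirr
  -- Gauss's lemma for monic polynomials over the integrally closed ring `k[x_1, …, x_m]`.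
  rw [(monic_rootSumPoly _ _).irreducible_iff_irreducible_map_fraction_map
    (K := FractionRing (MvPolynomial (Fin m) k)), rootSumPoly_map] at hirr'
  refine ⟨hirr, hirr', fun {K} _ _ x hx r hr => ?_⟩
  let e := hx.aevalEquivField
  have hmap : (rootSumPoly n fun j => algebraMap (MvPolynomial (Fin m) k)
        (FractionRing (MvPolynomial (Fin m) k)) (MvPolynomial.X j)).map
          (e.toRingEquiv : _ →+* IntermediateField.adjoin k (Set.range x)) =
      rootSumPoly n fun j =>
        (⟨x j, IntermediateField.subset_adjoin k (Set.range x) (Set.mem_range_self j)⟩ :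
          IntermediateField.adjoin k (Set.range x)) := by
    rw [rootSumPoly_map]
    congr 1
    ext j
    simp [e]
  refine (minpoly.eq_of_irreducible_of_monic ?_ ?_ (monic_rootSumPoly _ _)).symm
  · rw [← hmap]
    exact (MulEquiv.irreducible_iff (Polynomial.mapEquiv e.toRingEquiv)).2 hirr'
  · rw [Polynomial.aeval_def, ← Polynomial.eval_map, rootSumPoly_map]
    exact eval_rootSumPoly_sum hn hr
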